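/- Let $n\ge 0$ and $\lambda=(\lambda_1,\dots,\lambda_n)\in[0,1]^n$. A $\lambda$-contaminated dataset from a distribution $P$ on $\mathbb R$ is $Z=(Z_1,\dots,Z_n)$ with $Z_i=(1-B_i)X_i+B_i\tilde X_i$, where $X_1,\dots,X_n$ are i.i.d. from $P$, $B_i\sim\mathrm{Bern}(\lambda_i)$ are independent of each other and of the $X_i$, and the outliers $(\tilde X_1,\dots,\tilde X_n)$ are drawn by an adversary from an arbitrary joint distribution conditional on all $X_i$ and all $B_i$. Let $\mathcal D$ be the set of all distributions $\mathcal N(\mu,1)$, $\mu\in\mathbb R$, write $\mu_P$ for the mean of $P$, and define the minimax PAC rate $$L_{\mathsf{PAC}}(\lambda)=\inf\Big\{r\ge 0:\ \inf_M\ \sup_{P\in\mathcal D,\ \text{adversary}}\Pr\big[(M(Z)-\mu_P)^2\ge r\big]\le \tfrac15\Big\},$$ where $M$ ranges over all (measurable) estimators $M:\mathbb R^n\to\mathbb R$. For $t\in[0,1]$ let $N(t)=|\{i:\lambda_i\le t\}|$ (with $1/0=\infty$) and let $w(t)_i=\mathbf 1\{\lambda_i\le t\}/N(t)$. For weights $w$,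 a weighted Tukey median of $z\in\mathbb R^n$ is a maximizer over $\eta\in\mathbb R$ of the depth $\min_{v\in\{-1,1\}}\sum_i w_i\mathbf 1\{v(z_i-\eta)\ge 0\}$; for $w=w(t)$ with $N(t)>0$ this is a median of the samples with $\lambda_i\le t$. There are universal constants $c,a,A>0$ such that, for all $n$ and $\lambda\in[0,1]^n$ for which $$f(\lambda)=\min_{t\in[0,1]}\Big(t^2+\frac1{N(t)}\Big)$$ satisfies $f(\lambda)\le c$, one has $$a\,f(\lambda)\ \le\ L_{\mathsf{PAC}}(\lambda)\ \le\ A\,f(\lambda).$$ Moreover the minimum is attained, and for every minimizer $t^*\in[0,1]$ the Tukey median with weights $w(t^*)$ (that is, the median of the samples with $\lambda_i\le t^*$) achieves this rate: a measurable choice $M(z)$ of such a median for every $z$ exists, and every choice $M$ satisfies $\Pr[(M(Z)-\mu_P)^2\ge A\,f(\lambda)]\le \tfrac15$ for every $P\in\mathcal D$ and every adversary. -/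

import Mathlib

open MeasureTheory ProbabilityTheory
open scoped ENNReal

noncomputable section

namespace HeteroRobust

/-- An adversary: a conditional law of the outliers `(X̃₁, …, X̃ₙ)` given all clean samples
`(X₁, …, Xₙ)` and all corruption indicators `(B₁, …, Bₙ)` (`true` means corrupted). -/
abbrev Adversary (n : ℕ) (E : Type*) [MeasurableSpace E] :=
  {κ : Kernel ((Fin n → E) × (Fin n → Bool)) (Fin n → E) // IsMarkovKernel κ}

/-- The dataset `Zᵢ = (1 - Bᵢ) Xᵢ + Bᵢ X̃ᵢ`. -/
def mix {n : ℕ} {E : Type*} (s : ((Fin n → E) × (Fin n → Bool)) × (Fin n → E)) : Fin n → E :=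
  fun i => if s.1.2 i then s.2 i else s.1.1 i

/-- The law of a `lam`-contaminated dataset from `P` against the adversary `κ`: the `Xᵢ` are
i.i.d. from `P`, the `Bᵢ` are independent Bernoulli of parameter `lam i`, independent of the `Xᵢ`,
and the outliers are drawn from `κ` given these. -/
def contaminatedLaw {n : ℕ} {E : Type*} [MeasurableSpace E] (lam : Fin n → unitInterval)
    (P : ProbabilityMeasure E) (κ : Adversary n E) : Measure (Fin n → E) :=
  ((((Measure.pi fun _ : Fin n => (P : Measure E)).prod
    (Measure.pi fun i : Fin n => bernoulliMeasure true false (lam i))) ⊗ₘ κ.1).map mix)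

/-- The mean `μ_P` of a distribution. -/
def mean {E : Type*} [NormedAddCommGroup E] [NormedSpace ℝ E] [MeasurableSpace E]
    (P : ProbabilityMeasure E) : E :=
  ∫ x, x ∂(P : Measure E)

/-- The probability, under contaminated data, that the squared error of `M` is at least `r`. -/
def errorProb {n : ℕ} {E : Type*} [NormedAddCommGroup E] [NormedSpace ℝ E] [MeasurableSpace E]
    (lam : Fin n → unitInterval) (P : ProbabilityMeasure E) (κ : Adversary n E)
    (M : (Fin n → E) → E) (r : ℝ≥0∞) : ℝ≥0∞ :=
  contaminatedLaw lam P κ {z | r ≤ ENNReal.ofReal (‖M z - mean P‖ ^ 2)}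

/-- The minimax PAC rate at confidence level `δ`. The infimum runs over all (measurable)
estimators, the supremum over all distributions of the class and all adversaries. -/
def pacRate {n : ℕ} {E : Type*} [NormedAddCommGroup E] [NormedSpace ℝ E] [MeasurableSpace E]
    (lam : Fin n → unitInterval) (D : Set (ProbabilityMeasure E)) (δ : ℝ≥0∞) : ℝ≥0∞ :=
  sInf {r : ℝ≥0∞ | (⨅ M : {M : (Fin n → E) → E // Measurable M},
    ⨆ P ∈ D, ⨆ κ : Adversary n E, errorProb lam P κ M.1 r) ≤ δ}

/-- The univariate Gaussian distributions of unit variance. -/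
def unitGaussians : Set (ProbabilityMeasure ℝ) :=
  {P | ∃ m : ℝ, (P : Measure ℝ) = gaussianReal m 1}

/-- `N(t)`, the number of samples of corruption rate at most `t`. -/
def numBelow {n : ℕ} (lam : Fin n → unitInterval) (t : ℝ) : ℕ :=
  (Finset.univ.filter fun i => (lam i : ℝ) ≤ t).card

/-- `t² + 1 / N(t)`, which is `∞` when `N(t) = 0`. -/
def thresholdRate {n : ℕ} (lam : Fin n → unitInterval) (t : ℝ) : ℝ≥0∞ :=
  ENNReal.ofReal (t ^ 2) + 1 / (numBelow lam t : ℝ≥0∞)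

/-- The value `min_{t ∈ [0, 1]} (t² + 1 / N(t))`. -/
def minRate {n : ℕ} (lam : Fin n → unitInterval) : ℝ≥0∞ :=
  ⨅ t ∈ Set.Icc (0 : ℝ) 1, thresholdRate lam t

/-- The weights `w(t)ᵢ = 1{lam i ≤ t} / N(t)`. -/
def thresholdWeight {n : ℕ} (lam : Fin n → unitInterval) (t : ℝ) (i : Fin n) : ℝ :=
  (if (lam i : ℝ) ≤ t then 1 else 0) / (numBelow lam t : ℝ)

open Classical in
/-- The weighted Tukey depth
`D_w(η, z) = min over unit vectors v of ∑ᵢ wᵢ 1{⟨v, zᵢ - η⟩ ≥ 0}`. -/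
def tukeyDepth {n : ℕ} {E : Type*} [NormedAddCommGroup E] [InnerProductSpace ℝ E]
    (w : Fin n → ℝ) (z : Fin n → E) (η : E) : ℝ :=
  ⨅ v : Metric.sphere (0 : E) 1, ∑ i, w i * (if 0 ≤ inner ℝ (v : E) (z i - η) then 1 else 0)

/-- `η` is a weighted Tukey median of `z`: a point of maximal weighted depth. -/
def IsTukeyMedian {n : ℕ} {E : Type*} [NormedAddCommGroup E] [InnerProductSpace ℝ E]
    (w : Fin n → ℝ) (z : Fin n → E) (η : E) : Prop :=
  ∀ η' : E, tukeyDepth w z η' ≤ tukeyDepth w z η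

end HeteroRobust

end

/-!
Upper bound: the median of the samples with `lam i ≤ t` is `s` away from the mean `m` only if at
least half of them lie beyond `m + s`, or beyond `m - s`. A contaminated sample lies there only if
its clean value does or if it is corrupted, which are independent events of average probability
at most `1/2 - s/5 + t` whatever the adversary does, so Hoeffding's inequality applies as soon as
`s` is a large multiple of `t + 1 / √N(t)`.

Lower bound: Le Cam's method for `N(0, 1)` and `N(Δ, 1)`, whose total variation distance is at most
`2 Δ`. Outliers at a sample with `lam i > 2 Δ` can make the two hypotheses coincide there, so that
only the `N(2 Δ)` remaining samples carry information. The second moment of their likelihood ratio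
is `exp (N(2 Δ) Δ²)`, hence the hypotheses stay indistinguishable as long as `N(2 Δ) Δ²` is small,
which holds when `Δ²` is a small multiple of the minimum of `t² + 1 / N(t)`.
-/

open Filter Topology

noncomputable section

namespace HeteroRobust

section Median

variable {ι E F : Type*} [Fintype ι]

/-- The mass that the weighted empirical distribution `∑ᵢ wᵢ δ_{zᵢ}` gives to the set `T`. -/
def empiricalMass (w : ι → ℝ) (z : ι → E) (T : Set E) : ℝ :=
  ∑ i, T.indicator (fun _ => w i) (z i)

lemma empiricalMass_le_empiricalMass {w : ι → ℝ} (hw : ∀ i, 0 ≤ w i) {z : ι → E} {z' : ι → F}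
    {S : Set E} {T : Set F} (h : ∀ i, z i ∈ S → z' i ∈ T) :
    empiricalMass w z S ≤ empiricalMass w z' T :=
  Finset.sum_le_sum fun i _ => by
    by_cases hS : z i ∈ S
    · simp [hS, h i hS]
    · simpa [hS] using Set.indicator_nonneg (fun _ _ => hw i) _

lemma empiricalMass_mono {w : ι → ℝ} (hw : ∀ i, 0 ≤ w i) (z : ι → E) {S T : Set E} (h : S ⊆ T) :
    empiricalMass w z S ≤ empiricalMass w z T :=
  empiricalMass_le_empiricalMass hw fun _ hi => h hi

lemma empiricalMass_add_compl (w : ι → ℝ) (z : ι → E) (T : Set E) :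
    empiricalMass w z T + empiricalMass w z Tᶜ = ∑ i, w i := by
  simp only [empiricalMass, ← Finset.sum_add_distrib, Set.indicator_self_add_compl_apply]

lemma measurable_empiricalMass [MeasurableSpace E] (w : ι → ℝ) {T : Set E} (hT : MeasurableSet T) :
    Measurable fun z : ι → E => empiricalMass w z T :=
  Finset.measurable_sum _ fun i _ =>
    (measurable_const.indicator hT).comp (measurable_pi_apply i)

/-- The lower weighted median of `z`: the least point up to which at least half of the weight
lies. -/
def lowerMedian (w z : ι → ℝ) : ℝ :=
  sInf {x | ∑ i, w i ≤ 2 * empiricalMass w z (Set.Iic x)}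

variable {w : ι → ℝ}

lemma isLeast_lowerMedian (hw : ∀ i, 0 ≤ w i) (hw' : 0 < ∑ i, w i) (z : ι → ℝ) :
    IsLeast {x | ∑ i, w i ≤ 2 * empiricalMass w z (Set.Iic x)} (lowerMedian w z) := by
  set H : Set ℝ := {x | ∑ i, w i ≤ 2 * empiricalMass w z (Set.Iic x)} with hH
  have hne : H.Nonempty := by
    obtain ⟨b, hb⟩ := (Set.finite_range z).bddAbove
    have : empiricalMass w z (Set.Iic b) = ∑ i, w i :=
      Finset.sum_congr rfl fun i _ => Set.indicator_of_mem (show z i ∈ Set.Iic b from hb ⟨i, rfl⟩) _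
    exact ⟨b, by rw [hH, Set.mem_ofPred_eq, this]; linarith⟩
  have hbdd : BddBelow H := by
    obtain ⟨b, hb⟩ := (Set.finite_range z).bddBelow
    refine ⟨b, fun x hx => ?_⟩
    by_contra! hxb
    have hz : ∀ i, z i ∉ Set.Iic x := fun i h => (hxb.trans_le (hb ⟨i, rfl⟩)).not_ge h
    have : empiricalMass w z (Set.Iic x) = 0 :=
      Finset.sum_eq_zero fun i _ => Set.indicator_of_notMem (hz i) _
    rw [hH, Set.mem_ofPred_eq, this] at hx
    linarith
  refine ⟨?_, fun x hx => csInf_le hbdd hx⟩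
  -- right continuity of the weighted empirical distribution function
  have hright : ∀ᶠ x in 𝓝[>] lowerMedian w z, ∀ i, z i ≤ x → z i ≤ lowerMedian w z := by
    refine eventually_all.2 fun i => ?_
    by_cases hi : z i ≤ lowerMedian w z
    · exact .of_forall fun _ _ => hi
    · filter_upwards [Ioo_mem_nhdsGT (not_le.1 hi)] with x hx hix
      exact absurd hix hx.2.not_ge
  obtain ⟨x, hx, hmx⟩ := (hright.and self_mem_nhdsWithin).exists
  obtain ⟨y, hy, hyx⟩ := exists_lt_of_csInf_lt hne hmx
  calc ∑ i, w i ≤ 2 * empiricalMass w z (Set.Iic y) := hy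
    _ ≤ 2 * empiricalMass w z (Set.Iic (lowerMedian w z)) := by
      gcongr 2 * ?_
      exact empiricalMass_le_empiricalMass hw fun i hi => hx i (le_trans hi hyx.le)

lemma lowerMedian_le_iff (hw : ∀ i, 0 ≤ w i) (hw' : 0 < ∑ i, w i) {z : ι → ℝ} {x : ℝ} :
    lowerMedian w z ≤ x ↔ ∑ i, w i ≤ 2 * empiricalMass w z (Set.Iic x) := by
  obtain ⟨hmem, hle⟩ := isLeast_lowerMedian hw hw' z
  refine ⟨fun h => le_trans hmem ?_, fun h => hle h⟩
  gcongr 2 * ?_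
  exact empiricalMass_mono hw z (Set.Iic_subset_Iic.2 h)

lemma measurable_lowerMedian (hw : ∀ i, 0 ≤ w i) (hw' : 0 < ∑ i, w i) :
    Measurable (lowerMedian w) := by
  refine measurable_of_Iic fun x => ?_
  simp only [Set.preimage, Set.mem_Iic, lowerMedian_le_iff hw hw']
  exact measurableSet_le measurable_const
    ((measurable_empiricalMass w measurableSet_Iic).const_mul 2)

lemma sum_le_two_mul_empiricalMass_Ici_lowerMedian (hw : ∀ i, 0 ≤ w i) (hw' : 0 < ∑ i, w i)
    (z : ι → ℝ) : ∑ i, w i ≤ 2 * empiricalMass w z (Set.Ici (lowerMedian w z)) := by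
  have hleft : ∀ᶠ x in 𝓝[<] lowerMedian w z, ∀ i, z i < lowerMedian w z → z i ≤ x := by
    refine eventually_all.2 fun i => ?_
    by_cases hi : z i < lowerMedian w z
    · filter_upwards [Ioo_mem_nhdsLT hi] with x hx _ using hx.1.le
    · exact .of_forall fun _ h => absurd h hi
  obtain ⟨x, hx, hxm⟩ := (hleft.and self_mem_nhdsWithin).exists
  have hbelow : empiricalMass w z (Set.Iio (lowerMedian w z)) ≤ empiricalMass w z (Set.Iic x) :=
    empiricalMass_le_empiricalMass hw hx
  have hhalf := mt (lowerMedian_le_iff hw hw').2 (not_le.2 hxm)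
  have hsplit := empiricalMass_add_compl w z (Set.Ici (lowerMedian w z))
  rw [Set.compl_Ici] at hsplit
  linarith

lemma tukeyDepth_eq_min {n : ℕ} (w z : Fin n → ℝ) (η : ℝ) :
    tukeyDepth w z η = min (empiricalMass w z (Set.Ici η)) (empiricalMass w z (Set.Iic η)) := by
  classical
  let S := Metric.sphere (0 : ℝ) 1
  let depth : S → ℝ := fun v => ∑ i, w i * (if 0 ≤ inner ℝ (v : ℝ) (z i - η) then 1 else 0)
  let up : S := ⟨1, by simp [S]⟩
  let down : S := ⟨-1, by simp [S]⟩
  have hS : (Set.univ : Set S) = {up, down} := by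
    refine (Set.eq_univ_of_forall fun v => ?_).symm
    have hv : |(v : ℝ)| = 1 := mem_sphere_zero_iff_norm.1 v.2
    exact (eq_or_eq_neg_of_abs_eq hv).imp (fun h => Subtype.ext h) fun h => Subtype.ext h
  have hup : depth up = empiricalMass w z (Set.Ici η) := by
    simp [depth, up, empiricalMass, Set.indicator_apply]
  have hdown : depth down = empiricalMass w z (Set.Iic η) := by
    simp [depth, down, empiricalMass, Set.indicator_apply]
  calc tukeyDepth w z η = sInf (Set.range depth) := rfl
    _ = min (depth up) (depth down) := by
        rw [← Set.image_univ, hS, Set.image_pair, csInf_pair]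
    _ = _ := by rw [hup, hdown]

lemma isTukeyMedian_lowerMedian {n : ℕ} {w : Fin n → ℝ} (hw : ∀ i, 0 ≤ w i)
    (hw' : 0 < ∑ i, w i) (z : Fin n → ℝ) : IsTukeyMedian w z (lowerMedian w z) := fun η => by
  have hIic := (lowerMedian_le_iff hw hw').1 (le_refl (lowerMedian w z))
  have hIci := sum_le_two_mul_empiricalMass_Ici_lowerMedian hw hw' z
  rw [tukeyDepth_eq_min, tukeyDepth_eq_min]
  rcases lt_trichotomy η (lowerMedian w z) with h | rfl | h
  · have hη := mt (lowerMedian_le_iff hw hw').2 (not_le.2 h)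
    exact (min_le_right _ _).trans (le_min (by linarith) (by linarith))
  · rfl
  · have hη : empiricalMass w z (Set.Ici η) ≤ empiricalMass w z (Set.Iic (lowerMedian w z))ᶜ :=
      empiricalMass_mono hw z fun x hx => not_le.2 (h.trans_le hx)
    have hsplit := empiricalMass_add_compl w z (Set.Iic (lowerMedian w z))
    exact (min_le_left _ _).trans (le_min (by linarith) (by linarith))

lemma exists_measurable_isTukeyMedian {n : ℕ} {w : Fin n → ℝ} (hw : ∀ i, 0 ≤ w i)
    (hw' : 0 < ∑ i, w i) :
    ∃ M : (Fin n → ℝ) → ℝ, Measurable M ∧ ∀ z, IsTukeyMedian w z (M z) :=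
  ⟨lowerMedian w, measurable_lowerMedian hw hw', isTukeyMedian_lowerMedian hw hw'⟩

lemma IsTukeyMedian.sum_le_two_mul_tukeyDepth {n : ℕ} {w z : Fin n → ℝ} {η : ℝ}
    (h : IsTukeyMedian w z η) (hw : ∀ i, 0 ≤ w i) (hw' : 0 < ∑ i, w i) :
    ∑ i, w i ≤ 2 * tukeyDepth w z η := by
  have hIic := (lowerMedian_le_iff hw hw').1 (le_refl (lowerMedian w z))
  have hIci := sum_le_two_mul_empiricalMass_Ici_lowerMedian hw hw' z
  calc ∑ i, w i ≤ 2 * tukeyDepth w z (lowerMedian w z) := by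
        rw [tukeyDepth_eq_min, mul_min_of_nonneg _ _ zero_le_two]
        exact le_min hIci hIic
    _ ≤ 2 * tukeyDepth w z η := by
        gcongr 2 * ?_
        exact h _

end Median

section Contamination

variable {n : ℕ} {E : Type*} [MeasurableSpace E]

lemma measurable_mix :
    Measurable (mix : ((Fin n → E) × (Fin n → Bool)) × (Fin n → E) → Fin n → E) :=
  measurable_pi_lambda _ fun i =>
    Measurable.ite
      ((by fun_prop : Measurable fun s : ((Fin n → E) × (Fin n → Bool)) × (Fin n → E) => s.1.2 i)
        (measurableSet_singleton true)) (by fun_prop) (by fun_prop)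

lemma contaminatedLaw_apply_le (lam : Fin n → unitInterval) (P : ProbabilityMeasure E)
    (κ : Adversary n E) {A : Set (Fin n → E)} (hA : MeasurableSet A) {W : Set (Fin n → E × Bool)}
    (hW : MeasurableSet W) (h : ∀ x b y, mix ((x, b), y) ∈ A → (fun i => (x i, b i)) ∈ W) :
    contaminatedLaw lam P κ A ≤
      Measure.pi (fun i => (P : Measure E).prod (bernoulliMeasure true false (lam i))) W := by
  have hκ := κ.2
  let e := MeasurableEquiv.arrowProdEquivProdArrow E Bool (Fin n)
  have hW' : MeasurableSet (e.symm ⁻¹' W) := e.symm.measurable hW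
  rw [contaminatedLaw, Measure.map_apply measurable_mix hA]
  calc _ ≤ _ := measure_mono (t := Prod.fst ⁻¹' (e.symm ⁻¹' W))
        fun s hs => h s.1.1 s.1.2 s.2 hs
    _ = ((Measure.pi fun _ : Fin n => (P : Measure E)).prod
        (Measure.pi fun i : Fin n => bernoulliMeasure true false (lam i))) (e.symm ⁻¹' W) := by
      rw [← Measure.fst_apply hW', Measure.fst_compProd]
    _ = _ := by
      rw [← (measurePreserving_arrowProdEquivProdArrow E Bool (Fin n) (fun _ => (P : Measure E))
        (fun i => bernoulliMeasure true false (lam i))).measure_preimage hW'.nullMeasurableSet]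
      rfl

end Contamination

section Concentration

variable {ι : Type*} [Fintype ι]

lemma pi_sum_ge_le_exp {Ω : ι → Type*} [∀ i, MeasurableSpace (Ω i)] (μ : ∀ i, Measure (Ω i))
    [∀ i, IsProbabilityMeasure (μ i)] {w : ι → ℝ} {f : ∀ i, Ω i → ℝ} (hf : ∀ i, Measurable (f i))
    (hfw : ∀ i x, f i x ∈ Set.Icc 0 (w i)) {c d : ℝ} (hd : 0 ≤ d)
    (hc : ∑ i, ∫ x, f i x ∂μ i + d ≤ c) :
    Measure.pi μ {y | c ≤ ∑ i, f i (y i)} ≤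
      ENNReal.ofReal (Real.exp (-2 * d ^ 2 / ∑ i, w i ^ 2)) := by
  let X : ι → (∀ i, Ω i) → ℝ := fun i y => f i (y i) - ∫ x, f i x ∂μ i
  have hind : iIndepFun X (Measure.pi μ) :=
    iIndepFun_pi fun i => ((hf i).sub_const (∫ x, f i x ∂μ i)).aemeasurable
  have hsub : ∀ i ∈ Finset.univ,
      HasSubgaussianMGF (X i) ((‖w i - 0‖₊ / 2) ^ 2) (Measure.pi μ) := fun i _ => by
    have hX : X i = fun y => f i (y i) - ∫ y, f i (y i) ∂Measure.pi μ := by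
      simp only [X, integral_comp_eval (hf i).aestronglyMeasurable]
    rw [hX]
    exact hasSubgaussianMGF_of_mem_Icc ((hf i).comp (measurable_pi_apply i)).aemeasurable
      (.of_forall fun y => hfw i (y i))
  have hoeffding := HasSubgaussianMGF.measure_sum_ge_le_of_iIndepFun hind hsub hd
  calc Measure.pi μ {y | c ≤ ∑ i, f i (y i)}
      ≤ Measure.pi μ {y | d ≤ ∑ i, X i y} := measure_mono fun y (hy : c ≤ _) => by
        simp only [X, Set.mem_ofPred_eq, Finset.sum_sub_distrib]
        linarith
    _ ≤ _ := by
        rw [← ofReal_measureReal]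
        refine ENNReal.ofReal_le_ofReal (hoeffding.trans_eq ?_)
        congr 1
        push_cast
        simp only [sub_zero, div_pow, sq_abs, Real.norm_eq_abs, ← Finset.sum_div]
        ring_nf

end Concentration

section Upper

variable {n : ℕ} {E : Type*} [MeasurableSpace E] {w : Fin n → ℝ}

lemma contaminatedLaw_empiricalMass_ge_le (lam : Fin n → unitInterval) (P : ProbabilityMeasure E)
    (κ : Adversary n E) (hw : ∀ i, 0 ≤ w i) {T : Set E} (hT : MeasurableSet T) {c d : ℝ}
    (hd : 0 ≤ d) (hc : ∑ i, w i * ((P : Measure E).real T + lam i) + d ≤ c) :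
    contaminatedLaw lam P κ {z | c ≤ empiricalMass w z T} ≤
      ENNReal.ofReal (Real.exp (-2 * d ^ 2 / ∑ i, w i ^ 2)) := by
  let V : Set (E × Bool) := T ×ˢ Set.univ ∪ Set.univ ×ˢ {true}
  have hV : MeasurableSet V :=
    (hT.prod .univ).union (MeasurableSet.univ.prod (measurableSet_singleton true))
  have hVreal : ∀ i, ((P : Measure E).prod (bernoulliMeasure true false (lam i))).real V ≤
      (P : Measure E).real T + lam i := fun i => by
    refine (measureReal_union_le _ _).trans_eq ?_
    rw [measureReal_prod_prod, measureReal_prod_prod,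
      bernoulliMeasure_real_apply_of_mem_of_notMem _ (measurableSet_singleton _) rfl (by simp)]
    simp
  have hmix : ∀ x b y, mix ((x, b), y) ∈ {z | c ≤ empiricalMass w z T} →
      (fun i => (x i, b i)) ∈ {s | c ≤ empiricalMass w s V} := fun x b y hz =>
    le_trans (Set.mem_ofPred_eq ▸ hz) (empiricalMass_le_empiricalMass hw fun i hi => by
      by_cases hb : b i = true
      · exact .inr ⟨trivial, hb⟩
      · exact .inl ⟨by simpa [mix, hb] using hi, trivial⟩)
  refine (contaminatedLaw_apply_le lam P κ
    (measurableSet_le measurable_const (measurable_empiricalMass w hT))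
    (measurableSet_le measurable_const (measurable_empiricalMass w hV)) hmix).trans
    (pi_sum_ge_le_exp _ (fun i => measurable_const.indicator hV)
      (fun i y => ⟨Set.indicator_nonneg (fun _ _ => hw i) y,
        Set.indicator_le_self' (fun _ _ => hw i) y⟩) hd (le_trans ?_ hc))
  gcongr with i
  rw [integral_indicator_const _ hV, smul_eq_mul, mul_comm]
  exact mul_le_mul_of_nonneg_left (hVreal i) (hw i)

lemma errorProb_le_of_forall_isTukeyMedian (lam : Fin n → unitInterval) (P : ProbabilityMeasure ℝ)
    (κ : Adversary n ℝ) (hw : ∀ i, 0 ≤ w i) (hw' : ∑ i, w i = 1) {s d : ℝ} (hd : 0 ≤ d)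
    (hIci : (P : Measure ℝ).real (Set.Ici (mean P + s)) + ∑ i, w i * lam i + d ≤ 1 / 2)
    (hIic : (P : Measure ℝ).real (Set.Iic (mean P - s)) + ∑ i, w i * lam i + d ≤ 1 / 2)
    {M : (Fin n → ℝ) → ℝ} (hM : ∀ z, IsTukeyMedian w z (M z)) :
    errorProb lam P κ M (ENNReal.ofReal (s ^ 2)) ≤
      2 * ENNReal.ofReal (Real.exp (-2 * d ^ 2 / ∑ i, w i ^ 2)) := by
  have htail : ∀ T, MeasurableSet T →
      (P : Measure ℝ).real T + ∑ i, w i * lam i + d ≤ 1 / 2 →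
      contaminatedLaw lam P κ {z | 1 / 2 ≤ empiricalMass w z T} ≤
        ENNReal.ofReal (Real.exp (-2 * d ^ 2 / ∑ i, w i ^ 2)) := fun T hT h => by
    refine contaminatedLaw_empiricalMass_ge_le lam P κ hw hT hd (le_trans (le_of_eq ?_) h)
    rw [Finset.sum_congr rfl fun i _ => mul_add _ _ _, Finset.sum_add_distrib, ← Finset.sum_mul,
      hw', one_mul]
  rw [two_mul]
  refine (measure_mono fun z hz => ?_).trans ((measure_union_le _ _).trans
    (add_le_add (htail _ measurableSet_Ici hIci) (htail _ measurableSet_Iic hIic)))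
  have herr : s ≤ |M z - mean P| := by
    rw [Set.mem_ofPred_eq, ENNReal.ofReal_le_ofReal_iff (by positivity), Real.norm_eq_abs] at hz
    exact (le_abs_self s).trans (sq_le_sq.1 (by simpa only [sq_abs] using hz))
  have hdepth := (hM z).sum_le_two_mul_tukeyDepth hw (by rw [hw']; exact one_pos)
  rw [hw', tukeyDepth_eq_min, mul_min_of_nonneg _ _ zero_le_two, le_min_iff] at hdepth
  rcases le_abs.1 herr with h | h
  · have := empiricalMass_mono hw z (Set.Ici_subset_Ici.2 (by linarith : mean P + s ≤ M z))
    exact .inl (by rw [Set.mem_ofPred_eq]; linarith)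
  · have := empiricalMass_mono hw z (Set.Iic_subset_Iic.2 (by linarith : M z ≤ mean P - s))
    exact .inr (by rw [Set.mem_ofPred_eq]; linarith)

end Upper

section Threshold

variable {n : ℕ} {lam : Fin n → unitInterval}

-- `N` is a step function that jumps only at the corruption rates.
lemma exists_thresholdRate_le (lam : Fin n → unitInterval) (t : ℝ) :
    ∃ s ∈ insert (0 : ℝ) (Set.range fun i => (lam i : ℝ)),
      thresholdRate lam s ≤ thresholdRate lam t := by
  rcases (numBelow lam t).eq_zero_or_pos with h | h
  · exact ⟨0, .inl rfl, by simp [thresholdRate, h]⟩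
  · obtain ⟨j, hj, hmax⟩ := Finset.exists_max_image _ (fun i => (lam i : ℝ)) (Finset.card_pos.1 h)
    have hjt : (lam j : ℝ) ≤ t := (Finset.mem_filter.1 hj).2
    have hcard : numBelow lam t ≤ numBelow lam (lam j) :=
      Finset.card_le_card fun i hi => Finset.mem_filter.2 ⟨Finset.mem_univ i, hmax i hi⟩
    refine ⟨lam j, .inr ⟨j, rfl⟩, ?_⟩
    unfold thresholdRate
    gcongr
    exact (lam j).2.1

lemma insert_zero_range_subset_Icc (lam : Fin n → unitInterval) :
    insert (0 : ℝ) (Set.range fun i => (lam i : ℝ)) ⊆ Set.Icc 0 1 :=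
  Set.insert_subset ⟨le_rfl, zero_le_one⟩ (Set.range_subset_iff.2 fun i => (lam i).2)

lemma exists_isMinOn_thresholdRate (lam : Fin n → unitInterval) :
    ∃ t ∈ Set.Icc (0 : ℝ) 1, IsMinOn (thresholdRate lam) (Set.Icc 0 1) t := by
  obtain ⟨t, ht, hmin⟩ := Set.exists_min_image _ (thresholdRate lam)
    ((Set.finite_range fun i => (lam i : ℝ)).insert 0) (Set.insert_nonempty 0 _)
  refine ⟨t, insert_zero_range_subset_Icc lam ht, fun u _ => ?_⟩
  obtain ⟨s, hs, hsu⟩ := exists_thresholdRate_le lam u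
  exact (hmin s hs).trans hsu

lemma minRate_eq_of_isMinOn {t : ℝ} (ht : t ∈ Set.Icc (0 : ℝ) 1)
    (h : IsMinOn (thresholdRate lam) (Set.Icc 0 1) t) : minRate lam = thresholdRate lam t :=
  le_antisymm (iInf₂_le t ht) (le_iInf₂ fun _ hs => h hs)

lemma minRate_le_thresholdRate (lam : Fin n → unitInterval) (t : ℝ) :
    minRate lam ≤ thresholdRate lam t := by
  obtain ⟨s, hs, hst⟩ := exists_thresholdRate_le lam t
  exact (iInf₂_le s (insert_zero_range_subset_Icc lam hs)).trans hst

lemma numBelow_pos_of_thresholdRate_ne_top {t : ℝ} (h : thresholdRate lam t ≠ ⊤) :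
    0 < numBelow lam t := by
  refine Nat.pos_of_ne_zero fun h0 => h ?_
  simp [thresholdRate, h0]

lemma thresholdRate_eq_ofReal {t : ℝ} (h : 0 < numBelow lam t) :
    thresholdRate lam t = ENNReal.ofReal (t ^ 2 + 1 / numBelow lam t) := by
  have h' : (0 : ℝ) < numBelow lam t := by exact_mod_cast h
  rw [thresholdRate, ENNReal.ofReal_add (by positivity) (by positivity),
    ENNReal.ofReal_div_of_pos h', ENNReal.ofReal_one, ENNReal.ofReal_natCast]

lemma thresholdWeight_nonneg (lam : Fin n → unitInterval) (t : ℝ) (i : Fin n) :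
    0 ≤ thresholdWeight lam t i := by
  unfold thresholdWeight
  positivity

lemma sum_thresholdWeight {t : ℝ} (h : 0 < numBelow lam t) :
    ∑ i, thresholdWeight lam t i = 1 := by
  simp only [thresholdWeight, ← Finset.sum_div, Finset.sum_boole]
  exact div_self (by exact_mod_cast h.ne')

lemma sum_thresholdWeight_sq (lam : Fin n → unitInterval) (t : ℝ) :
    ∑ i, thresholdWeight lam t i ^ 2 = 1 / numBelow lam t := by
  simp only [thresholdWeight, div_pow, ite_pow, one_pow, zero_pow two_ne_zero, ← Finset.sum_div,
    Finset.sum_boole]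
  rw [← numBelow, sq, div_self_mul_self', one_div]

lemma sum_thresholdWeight_mul_le {t : ℝ} (h : 0 < numBelow lam t) :
    ∑ i, thresholdWeight lam t i * lam i ≤ t := by
  calc ∑ i, thresholdWeight lam t i * lam i ≤ ∑ i, thresholdWeight lam t i * t :=
        Finset.sum_le_sum fun i _ => by
          by_cases hi : (lam i : ℝ) ≤ t
          · exact mul_le_mul_of_nonneg_left hi (thresholdWeight_nonneg lam t i)
          · simp [thresholdWeight, hi]
    _ = t := by rw [← Finset.sum_mul, sum_thresholdWeight h, one_mul]

end Threshold

section PacRate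

variable {n : ℕ} {E : Type*} [NormedAddCommGroup E] [NormedSpace ℝ E] [MeasurableSpace E]
  {lam : Fin n → unitInterval} {D : Set (ProbabilityMeasure E)} {δ : ℝ≥0∞}

lemma pacRate_le {M : (Fin n → E) → E} (hM : Measurable M) {r : ℝ≥0∞}
    (h : ∀ P ∈ D, ∀ κ, errorProb lam P κ M r ≤ δ) : pacRate lam D δ ≤ r := by
  refine sInf_le ?_
  rw [Set.mem_ofPred_eq]
  exact iInf_le_of_le ⟨M, hM⟩ (iSup₂_le fun P hP => iSup_le (h P hP))

lemma le_pacRate {p b : ℝ≥0∞} (hp : δ < p)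
    (h : ∀ r < b, ∀ M : (Fin n → E) → E, Measurable M → ∃ P ∈ D, ∃ κ, p ≤ errorProb lam P κ M r) :
    b ≤ pacRate lam D δ := by
  refine le_sInf fun r hr => ?_
  by_contra! hrb
  refine (hp.trans_le (le_iInf fun M => ?_)).not_ge hr
  obtain ⟨P, hP, κ, hκ⟩ := h r hrb M.1 M.2
  exact hκ.trans (le_iSup₂_of_le P hP (le_iSup (fun κ => errorProb lam P κ M.1 r) κ))

lemma errorProb_anti (lam : Fin n → unitInterval) (P : ProbabilityMeasure E) (κ : Adversary n E)
    (M : (Fin n → E) → E) : Antitone (errorProb lam P κ M) :=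
  fun _ _ h => measure_mono fun _ hz => h.trans hz

end PacRate

section GaussianTail

lemma gaussianReal_real_Iic_sub (m : ℝ) (v : NNReal) (s : ℝ) :
    (gaussianReal m v).real (Set.Iic (m - s)) = (gaussianReal m v).real (Set.Ici (m + s)) := by
  have hreflect : (gaussianReal m v).map (fun x => 2 * m - x) = gaussianReal m v := by
    rw [gaussianReal_map_const_sub, two_mul, add_sub_cancel_right]
  conv_lhs => rw [← hreflect]
  rw [map_measureReal_apply (by fun_prop) measurableSet_Iic]
  congr 1
  ext x
  simp only [Set.mem_preimage, Set.mem_Iic, Set.mem_Ici]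
  constructor <;> intro h <;> linarith

lemma one_fifth_le_gaussianPDFReal {m x : ℝ} (hx : |x - m| ≤ 1) :
    1 / 5 ≤ gaussianPDFReal m 1 x := by
  have hsq : (x - m) ^ 2 ≤ 1 := (sq_le_one_iff_abs_le_one _).2 hx
  have hsqrt : √(2 * Real.pi) ≤ 3 :=
    Real.sqrt_le_iff.2 ⟨by norm_num, by nlinarith [Real.pi_lt_d2]⟩
  have hexp : 3 / 5 ≤ Real.exp (-(1 / 2)) := by
    refine le_of_sq_le_sq ?_ (Real.exp_pos _).le
    calc (3 / 5 : ℝ) ^ 2 ≤ Real.exp (-1) := by linarith [Real.exp_neg_one_gt_d9]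
      _ = Real.exp (-(1 / 2)) ^ 2 := by rw [← Real.exp_nat_mul]; norm_num
  calc (1 / 5 : ℝ) = 3⁻¹ * (3 / 5) := by norm_num
    _ ≤ (√(2 * Real.pi))⁻¹ * Real.exp (-(x - m) ^ 2 / 2) := by
      gcongr
      exact hexp.trans (Real.exp_le_exp.2 (by linarith))
    _ = gaussianPDFReal m 1 x := by simp [gaussianPDFReal]

lemma gaussianReal_real_Ici_add_le (m : ℝ) {s : ℝ} (h0 : 0 < s) (h1 : s ≤ 1) :
    (gaussianReal m 1).real (Set.Ici (m + s)) ≤ 1 / 2 - s / 5 := by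
  have hcentre : 2 * s / 5 ≤ (gaussianReal m 1).real (Set.Ioo (m - s) (m + s)) := by
    rw [measureReal_def, gaussianReal_apply_eq_integral _ one_ne_zero, ENNReal.toReal_ofReal
      (setIntegral_nonneg measurableSet_Ioo fun x _ => gaussianPDFReal_nonneg _ _ _)]
    calc 2 * s / 5 = ∫ _ in Set.Ioo (m - s) (m + s), (1 / 5 : ℝ) := by
          rw [setIntegral_const, Real.volume_real_Ioo_of_le (by linarith), smul_eq_mul]
          ring
      _ ≤ _ := setIntegral_mono_on (by simp) (integrable_gaussianPDFReal m 1).integrableOn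
        measurableSet_Ioo fun x hx => one_fifth_le_gaussianPDFReal
          (abs_le.2 ⟨by linarith [hx.1], by linarith [hx.2]⟩)
  have hsplit : (gaussianReal m 1).real (Set.Iic (m - s)) +
      (gaussianReal m 1).real (Set.Ioo (m - s) (m + s)) =
      1 - (gaussianReal m 1).real (Set.Ici (m + s)) := by
    rw [← probReal_compl_eq_one_sub measurableSet_Ici, Set.compl_Ici,
      ← Set.Iic_union_Ioo_eq_Iio (by linarith : m - s < m + s), measureReal_union
      ((Set.Iic_disjoint_Ioi le_rfl).mono_right Set.Ioo_subset_Ioi_self) measurableSet_Ioo]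
  rw [gaussianReal_real_Iic_sub] at hsplit
  linarith

lemma mean_eq_of_eq_gaussianReal {P : ProbabilityMeasure ℝ} {m : ℝ} {v : NNReal}
    (h : (P : Measure ℝ) = gaussianReal m v) : mean P = m := by
  rw [mean, h, integral_id_gaussianReal]

end GaussianTail

section GaussianUpper

variable {n : ℕ} {lam : Fin n → unitInterval}

-- The error `15 √F` costs the tails `3 √F`, which leaves `2 √F` for the fluctuations once the
-- corruption has taken `√F`.
lemma errorProb_le_one_fifth_of_forall_isTukeyMedian {w : Fin n → ℝ} (hw : ∀ i, 0 ≤ w i)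
    (hw' : ∑ i, w i = 1) {F : ℝ} (hF : (∑ i, w i * lam i) ^ 2 + ∑ i, w i ^ 2 ≤ F)
    (hF' : F ≤ 1 / 225) {M : (Fin n → ℝ) → ℝ} (hM : ∀ z, IsTukeyMedian w z (M z))
    {P : ProbabilityMeasure ℝ} (hP : P ∈ unitGaussians) (κ : Adversary n ℝ) :
    errorProb lam P κ M (ENNReal.ofReal (225 * F)) ≤ 1 / 5 := by
  obtain ⟨m, hm⟩ := hP
  have hvar : 0 < ∑ i, w i ^ 2 := by
    obtain ⟨i, hi, hwi⟩ := Finset.exists_ne_zero_of_sum_ne_zero (hw'.trans_ne one_ne_zero)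
    exact Finset.sum_pos' (fun i _ => sq_nonneg (w i)) ⟨i, hi, by positivity⟩
  have hFpos : 0 < F := by nlinarith [sq_nonneg (∑ i, w i * lam i : ℝ)]
  have hsq : √F ^ 2 = F := Real.sq_sqrt hFpos.le
  have hs : 15 * √F ≤ 1 := by nlinarith [Real.sqrt_nonneg F]
  have hbias : ∑ i, w i * lam i ≤ √F := Real.le_sqrt_of_sq_le (by linarith)
  have htail := gaussianReal_real_Ici_add_le m (by positivity) hs
  have herr := errorProb_le_of_forall_isTukeyMedian lam P κ hw hw' (s := 15 * √F)
    (d := 2 * √F) (by positivity)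
    (by rw [mean_eq_of_eq_gaussianReal hm, hm]; linarith)
    (by rw [mean_eq_of_eq_gaussianReal hm, hm, gaussianReal_real_Iic_sub]; linarith) hM
  have hexp : Real.exp (-2 * (2 * √F) ^ 2 / ∑ i, w i ^ 2) ≤ 1 / 10 := by
    calc Real.exp (-2 * (2 * √F) ^ 2 / ∑ i, w i ^ 2) ≤ Real.exp (-8) := by
          rw [mul_pow, hsq, Real.exp_le_exp, div_le_iff₀ hvar]
          nlinarith [sq_nonneg (∑ i, w i * lam i : ℝ)]
      _ ≤ 10⁻¹ := by
          rw [Real.exp_neg]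
          gcongr
          linarith [Real.quadratic_le_exp_of_nonneg (by norm_num : (0 : ℝ) ≤ 8)]
      _ = 1 / 10 := by norm_num
  rw [show 225 * F = (15 * √F) ^ 2 by rw [mul_pow, hsq]; norm_num]
  calc _ ≤ 2 * ENNReal.ofReal (1 / 10) := herr.trans (by gcongr)
    _ = ENNReal.ofReal (1 / 5) := by
        rw [show (2 : ℝ≥0∞) = ENNReal.ofReal 2 by norm_num, ← ENNReal.ofReal_mul (by norm_num)]
        norm_num
    _ = 1 / 5 := by rw [ENNReal.ofReal_div_of_pos (by norm_num)]; norm_num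

lemma errorProb_le_one_fifth_of_thresholdRate_le {t : ℝ}
    (hf : thresholdRate lam t ≤ ENNReal.ofReal (1 / 225)) {M : (Fin n → ℝ) → ℝ}
    (hM : ∀ z, IsTukeyMedian (thresholdWeight lam t) z (M z))
    {P : ProbabilityMeasure ℝ} (hP : P ∈ unitGaussians) (κ : Adversary n ℝ) :
    errorProb lam P κ M (ENNReal.ofReal 225 * thresholdRate lam t) ≤ 1 / 5 := by
  have hN := numBelow_pos_of_thresholdRate_ne_top (ne_top_of_le_ne_top ENNReal.ofReal_ne_top hf)
  rw [thresholdRate_eq_ofReal hN] at hf ⊢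
  rw [← ENNReal.ofReal_mul (by norm_num)]
  refine errorProb_le_one_fifth_of_forall_isTukeyMedian (thresholdWeight_nonneg lam t)
    (sum_thresholdWeight hN) ?_ ((ENNReal.ofReal_le_ofReal_iff (by norm_num)).1 hf) hM hP κ
  rw [sum_thresholdWeight_sq]
  gcongr
  · exact Finset.sum_nonneg fun i _ => mul_nonneg (thresholdWeight_nonneg lam t i) (lam i).2.1
  · exact sum_thresholdWeight_mul_le hN

lemma exists_measurable_isTukeyMedian_thresholdWeight {t : ℝ} (hf : thresholdRate lam t ≠ ⊤) :
    ∃ M : (Fin n → ℝ) → ℝ, Measurable M ∧ ∀ z, IsTukeyMedian (thresholdWeight lam t) z (M z) :=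
  exists_measurable_isTukeyMedian (thresholdWeight_nonneg lam t) <|
    sum_thresholdWeight (numBelow_pos_of_thresholdRate_ne_top hf) ▸ one_pos

lemma pacRate_le_ofReal_mul_thresholdRate {t : ℝ}
    (hf : thresholdRate lam t ≤ ENNReal.ofReal (1 / 225)) :
    pacRate lam unitGaussians (1 / 5) ≤ ENNReal.ofReal 225 * thresholdRate lam t := by
  obtain ⟨M, hM, hmedian⟩ := exists_measurable_isTukeyMedian_thresholdWeight
    (ne_top_of_le_ne_top ENNReal.ofReal_ne_top hf)
  exact pacRate_le hM fun P hP κ => errorProb_le_one_fifth_of_thresholdRate_le hf hmedian hP κ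

end GaussianUpper

section ChiSquare

variable {Ω : Type*} [MeasurableSpace Ω] {Q : Measure Ω} {L : Ω → ℝ≥0∞}

-- Integrate `2 ε (L - 1)₊ + 2 L ≤ L² + 1 + ε²`, which is `(L - 1 - ε)² ≥ 0` where `L ≥ 1`.
lemma lintegral_tsub_one_le_of_lintegral_sq_le [IsProbabilityMeasure Q] (hL : Measurable L)
    (hL1 : ∫⁻ x, L x ∂Q = 1) {ε : NNReal} (hε : ε ≠ 0)
    (hL2 : ∫⁻ x, L x ^ 2 ∂Q ≤ 1 + (ε : ℝ≥0∞) ^ 2) : ∫⁻ x, (L x - 1) ∂Q ≤ ε := by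
  have hpt : ∀ x, 2 * ε * (L x - 1) + 2 * L x ≤ L x ^ 2 + (1 + (ε : ℝ≥0∞) ^ 2) := fun x => by
    rcases eq_or_ne (L x) ⊤ with h | h
    · simp [h]
    lift L x to NNReal using h with y
    norm_cast
    rw [← NNReal.coe_le_coe]
    rcases le_total 1 y with h | h
    · push_cast [h]
      nlinarith [sq_nonneg ((y : ℝ) - 1 - ε)]
    · rw [tsub_eq_zero_of_le h]
      push_cast
      nlinarith [sq_nonneg ((y : ℝ) - 1), sq_nonneg (ε : ℝ)]
  have hint := lintegral_mono (μ := Q) hpt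
  rw [lintegral_add_right _ (hL.const_mul _), lintegral_const_mul _ (hL.sub_const 1),
    lintegral_const_mul _ hL, hL1, lintegral_add_right _ measurable_const, lintegral_const,
    measure_univ, mul_one, mul_one] at hint
  have hsum : 2 * ε * ∫⁻ x, (L x - 1) ∂Q + 2 ≤ 2 * ε * ε + 2 :=
    calc _ ≤ _ := hint
      _ ≤ (1 + (ε : ℝ≥0∞) ^ 2) + (1 + (ε : ℝ≥0∞) ^ 2) := by gcongr
      _ = 2 * ε * ε + 2 := by ring
  exact (ENNReal.mul_le_mul_iff_right (by simpa using hε) (by finiteness)).1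
    ((ENNReal.add_le_add_iff_right (by finiteness)).1 hsum)

lemma withDensity_apply_le_add_lintegral_tsub_one {s : Set Ω}
    (hs : MeasurableSet s) : Q.withDensity L s ≤ Q s + ∫⁻ x, (L x - 1) ∂Q := by
  calc Q.withDensity L s = ∫⁻ x in s, L x ∂Q := withDensity_apply _ hs
    _ ≤ ∫⁻ x in s, (1 + (L x - 1)) ∂Q := lintegral_mono fun x => le_add_tsub
    _ = Q s + ∫⁻ x in s, (L x - 1) ∂Q := by
      rw [lintegral_add_left measurable_const, setLIntegral_one]
    _ ≤ Q s + ∫⁻ x, (L x - 1) ∂Q := by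
      gcongr
      exact Measure.restrict_le_self

end ChiSquare

section Product

variable {ι : Type*} [Fintype ι] {Ω : ι → Type*} [∀ i, MeasurableSpace (Ω i)]
  (μ : ∀ i, Measure (Ω i)) [∀ i, IsProbabilityMeasure (μ i)] {g : ∀ i, Ω i → ℝ≥0∞}

lemma lintegral_pi_prod (hg : ∀ i, Measurable (g i)) :
    ∫⁻ y, ∏ i, g i (y i) ∂Measure.pi μ = ∏ i, ∫⁻ x, g i x ∂μ i :=
  (lintegral_prod_eq_prod_lintegral_of_indepFun Finset.univ
    (fun i (y : ∀ i, Ω i) => g i (y i)) (iIndepFun_pi fun i => (hg i).aemeasurable)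
    (fun i => (hg i).comp (measurable_pi_apply i))).trans <|
  Finset.prod_congr rfl fun i _ => (measurePreserving_eval μ i).lintegral_comp (hg i)

lemma pi_withDensity (hg : ∀ i, Measurable (g i)) [∀ i, SigmaFinite ((μ i).withDensity (g i))] :
    Measure.pi (fun i => (μ i).withDensity (g i)) =
      (Measure.pi μ).withDensity fun y => ∏ i, g i (y i) := by
  refine Measure.pi_eq fun s hs => ?_
  have hprod : ∀ y, (Set.univ.pi s).indicator (fun y => ∏ i, g i (y i)) y =
      ∏ i, (s i).indicator (g i) (y i) := fun y => by
    classical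
    simp [Set.indicator_apply, Finset.prod_ite_zero]
  rw [withDensity_apply _ (.univ_pi hs), ← lintegral_indicator (.univ_pi hs)]
  simp_rw [hprod]
  rw [lintegral_pi_prod μ fun i => (hg i).indicator (hs i)]
  refine Finset.prod_congr rfl fun i _ => ?_
  rw [lintegral_indicator (hs i), withDensity_apply _ (hs i)]

end Product

section Contaminate

variable {E : Type*} [MeasurableSpace E]

/-- The `lam`-contamination `(1 - lam) P + lam R` of the distribution `P` by `R`. -/
def contaminate (lam : unitInterval) (P R : Measure E) : Measure E :=
  (unitInterval.toNNReal (unitInterval.symm lam) : ℝ≥0∞) • P +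
    (unitInterval.toNNReal lam : ℝ≥0∞) • R

lemma toNNReal_symm_add_toNNReal (lam : unitInterval) :
    (unitInterval.toNNReal (unitInterval.symm lam) : ℝ≥0∞) + unitInterval.toNNReal lam = 1 := by
  rw [← ENNReal.coe_add, ENNReal.coe_eq_one]
  ext
  simp

lemma contaminate_self (lam : unitInterval) (P : Measure E) : contaminate lam P P = P := by
  rw [contaminate, ← add_smul, toNNReal_symm_add_toNNReal, one_smul]

instance (lam : unitInterval) (P R : Measure E) [IsProbabilityMeasure P]
    [IsProbabilityMeasure R] : IsProbabilityMeasure (contaminate lam P R) :=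
  ⟨by simp [contaminate, toNNReal_symm_add_toNNReal]⟩

/-- The sample `(1 - b) x + b y` obtained from `((x, b), y)`: one coordinate of `mix`. -/
def mixSample (s : (E × Bool) × E) : E :=
  if s.1.2 then s.2 else s.1.1

lemma measurable_mixSample : Measurable (mixSample : (E × Bool) × E → E) :=
  Measurable.ite ((by fun_prop : Measurable fun s : (E × Bool) × E => s.1.2)
    (measurableSet_singleton true)) (by fun_prop) (by fun_prop)

lemma map_mixSample (lam : unitInterval) (P R : Measure E) [IsProbabilityMeasure P]
    [IsProbabilityMeasure R] :
    ((P.prod (bernoulliMeasure true false lam)).prod R).map mixSample = contaminate lam P R := by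
  ext s hs
  have hpre : mixSample ⁻¹' s = (s ×ˢ {false}) ×ˢ Set.univ ∪ (Set.univ ×ˢ {true}) ×ˢ s := by
    ext ⟨⟨x, b⟩, y⟩
    cases b <;> simp [mixSample]
  have hdisj : Disjoint ((s ×ˢ {false}) ×ˢ (Set.univ : Set E))
      (((Set.univ : Set E) ×ˢ {true}) ×ˢ s) :=
    Set.disjoint_prod.2 (.inl (Set.disjoint_prod.2 (.inr (by simp))))
  rw [Measure.map_apply measurable_mixSample hs, hpre,
    measure_union hdisj ((MeasurableSet.univ.prod (measurableSet_singleton _)).prod hs)]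
  simp only [Measure.prod_prod, measure_univ, one_mul, mul_one, contaminate,
    Measure.add_apply, Measure.smul_apply, smul_eq_mul]
  rw [bernoulliMeasure_apply_of_mem_of_notMem _ (measurableSet_singleton true) rfl (by simp),
    bernoulliMeasure_apply_of_notMem_of_mem _ (measurableSet_singleton false) (by simp) rfl,
    mul_comm]

/-- The adversary that draws the outliers independently of each other, of the clean samples and of
the corruption indicators, the `i`-th one from `R i`. -/
def obliviousAdversary {n : ℕ} (R : Fin n → Measure E) [∀ i, IsProbabilityMeasure (R i)] :
    Adversary n E :=
  ⟨Kernel.const _ (Measure.pi R), inferInstance⟩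

lemma contaminatedLaw_obliviousAdversary {n : ℕ} (lam : Fin n → unitInterval)
    (P : ProbabilityMeasure E) (R : Fin n → Measure E) [∀ i, IsProbabilityMeasure (R i)] :
    contaminatedLaw lam P (obliviousAdversary R) =
      Measure.pi fun i => contaminate (lam i) (P : Measure E) (R i) := by
  have hclean := measurePreserving_arrowProdEquivProdArrow E Bool (Fin n)
    (fun _ => (P : Measure E)) (fun i => bernoulliMeasure true false (lam i))
  have hall := (hclean.prod (MeasurePreserving.id (Measure.pi R))).comp
    (measurePreserving_arrowProdEquivProdArrow (E × Bool) E (Fin n)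
      (fun i => (P : Measure E).prod (bernoulliMeasure true false (lam i))) R)
  have (i : Fin n) : IsProbabilityMeasure
      ((((P : Measure E).prod (bernoulliMeasure true false (lam i))).prod (R i)).map mixSample) :=
    Measure.isProbabilityMeasure_map measurable_mixSample.aemeasurable
  simp_rw [← map_mixSample]
  rw [← Measure.pi_map_pi fun i => measurable_mixSample.aemeasurable]
  change ((_ ⊗ₘ Kernel.const _ (Measure.pi R)).map mix) = _
  rw [Measure.compProd_const, ← hall.map_eq, Measure.map_map measurable_mix hall.measurable]
  rfl

lemma exists_contaminate_eq_of_add_eq_add {P Q ν₀ ν₁ : Measure E} [IsProbabilityMeasure P]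
    [IsProbabilityMeasure Q] (h : P + ν₀ = Q + ν₁) {lam : unitInterval} (h0 : lam ≠ 0)
    (hν : ν₀ Set.univ ≤ unitInterval.toNNReal lam) :
    ∃ R₀ R₁ : Measure E, IsProbabilityMeasure R₀ ∧ IsProbabilityMeasure R₁ ∧
      contaminate lam P R₀ = contaminate lam Q R₁ := by
  set l : ℝ≥0∞ := (unitInterval.toNNReal lam : ℝ≥0∞) with hl
  set k : ℝ≥0∞ := (unitInterval.toNNReal (unitInterval.symm lam) : ℝ≥0∞) with hk
  have hl0 : l ≠ 0 := fun hl0 => h0 <| Subtype.ext <|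
    congrArg NNReal.toReal (ENNReal.coe_eq_zero.1 hl0)
  have hltop : l ≠ ⊤ := ENNReal.coe_ne_top
  have hk1 : k ≤ 1 := toNNReal_symm_add_toNNReal lam ▸ le_self_add
  have hmass : ν₁ Set.univ = ν₀ Set.univ := by
    have := congrArg (· Set.univ) h
    simp only [Measure.add_apply, measure_univ] at this
    exact ((ENNReal.add_right_inj ENNReal.one_ne_top).1 this).symm
  let outliers : Measure E → Measure E := fun ν => l⁻¹ • (k • ν + (l - k * ν₀ Set.univ) • P)
  have hprob : ∀ ν : Measure E, ν Set.univ = ν₀ Set.univ → IsProbabilityMeasure (outliers ν) :=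
    fun ν hν' => ⟨by
      simp only [outliers, Measure.smul_apply, Measure.add_apply, smul_eq_mul, measure_univ,
        mul_one, hν']
      rw [add_tsub_cancel_of_le ((mul_le_of_le_one_left zero_le hk1).trans hν),
        ENNReal.inv_mul_cancel hl0 hltop]⟩
  have hsmul : ∀ ν : Measure E, l • l⁻¹ • ν = ν := fun ν => by
    rw [smul_smul, ENNReal.mul_inv_cancel hl0 hltop, one_smul]
  refine ⟨outliers ν₀, outliers ν₁, hprob ν₀ rfl, hprob ν₁ hmass, ?_⟩
  rw [contaminate, contaminate, ← hl, ← hk, hsmul, hsmul, ← add_assoc, ← add_assoc, ← smul_add,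
    ← smul_add, h]

lemma add_withDensity_tsub_one (P : Measure E) {L : E → ℝ≥0∞} (hL : Measurable L) :
    P + P.withDensity (fun x => L x - 1) =
      P.withDensity L + P.withDensity (fun x => 1 - L x) := by
  calc P + P.withDensity (fun x => L x - 1)
      = P.withDensity (1 + fun x => L x - 1) := by
        rw [withDensity_add_left measurable_one, withDensity_one]
    _ = P.withDensity (L + fun x => 1 - L x) := by
        congr 1
        ext x
        simp [add_tsub_eq_max, max_comm]
    _ = _ := withDensity_add_left hL _

variable {P Q : Measure E} [IsProbabilityMeasure P] [IsProbabilityMeasure Q] {L : E → ℝ≥0∞}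

lemma exists_contaminate_eq_withDensity (hL : Measurable L) (hQ : P.withDensity L = Q) {t : ℝ}
    (ht : 0 ≤ t) (hTV : ∫⁻ x, (L x - 1) ∂P ≤ ENNReal.ofReal t) (lam : unitInterval) :
    ∃ (R₀ R₁ : Measure E) (g : E → ℝ≥0∞), IsProbabilityMeasure R₀ ∧ IsProbabilityMeasure R₁ ∧
      Measurable g ∧ contaminate lam Q R₁ = (contaminate lam P R₀).withDensity g ∧
      ∫⁻ x, g x ^ 2 ∂contaminate lam P R₀ = if (lam : ℝ) ≤ t then ∫⁻ x, L x ^ 2 ∂P else 1 := by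
  by_cases h : (lam : ℝ) ≤ t
  · refine ⟨P, Q, L, inferInstance, inferInstance, hL, ?_, ?_⟩
    · rw [contaminate_self, contaminate_self, hQ]
    · rw [contaminate_self, if_pos h]
  · have hlam : t < lam := not_le.1 h
    have hmass : P.withDensity (fun x => L x - 1) Set.univ ≤ unitInterval.toNNReal lam := by
      rw [withDensity_apply _ .univ, setLIntegral_univ, ← ENNReal.ofReal_coe_nnreal]
      exact hTV.trans (ENNReal.ofReal_le_ofReal hlam.le)
    obtain ⟨R₀, R₁, hR₀, hR₁, heq⟩ := exists_contaminate_eq_of_add_eq_add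
      (hQ ▸ add_withDensity_tsub_one P hL) (fun h0 => h (by simpa [h0] using ht)) hmass
    refine ⟨R₀, R₁, 1, hR₀, hR₁, measurable_one, ?_, ?_⟩
    · rw [withDensity_one, heq]
    · simp [if_neg h]

instance {n : ℕ} (lam : Fin n → unitInterval) (P : ProbabilityMeasure E) (κ : Adversary n E) :
    IsProbabilityMeasure (contaminatedLaw lam P κ) :=
  have := κ.2
  Measure.isProbabilityMeasure_map measurable_mix.aemeasurable

lemma exists_contaminatedLaw_eq_withDensity {n : ℕ} {P Q : ProbabilityMeasure E} {L : E → ℝ≥0∞}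
    (hL : Measurable L) (hQ : (P : Measure E).withDensity L = Q) {t : ℝ} (ht : 0 ≤ t)
    (hTV : ∫⁻ x, (L x - 1) ∂(P : Measure E) ≤ ENNReal.ofReal t) (lam : Fin n → unitInterval) :
    ∃ (κ₀ κ₁ : Adversary n E) (G : (Fin n → E) → ℝ≥0∞), Measurable G ∧
      contaminatedLaw lam Q κ₁ = (contaminatedLaw lam P κ₀).withDensity G ∧
      ∫⁻ z, G z ^ 2 ∂contaminatedLaw lam P κ₀ =
        (∫⁻ x, L x ^ 2 ∂(P : Measure E)) ^ numBelow lam t := by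
  choose R₀ R₁ g hR₀ hR₁ hg hdens hsq using fun i =>
    exists_contaminate_eq_withDensity hL hQ ht hTV (lam i)
  have (i : Fin n) :
      IsProbabilityMeasure ((contaminate (lam i) (P : Measure E) (R₀ i)).withDensity (g i)) :=
    hdens i ▸ inferInstance
  refine ⟨obliviousAdversary R₀, obliviousAdversary R₁, fun z => ∏ i, g i (z i),
    Finset.measurable_fun_prod _ fun i _ => (hg i).comp (measurable_pi_apply i), ?_, ?_⟩
  · simp_rw [contaminatedLaw_obliviousAdversary, hdens]
    exact pi_withDensity _ hg
  · simp_rw [contaminatedLaw_obliviousAdversary, ← Finset.prod_pow]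
    rw [lintegral_pi_prod (g := fun i x => g i x ^ 2) _ fun i => (hg i).pow_const 2]
    simp_rw [hsq]
    rw [← Finset.prod_filter, Finset.prod_const, numBelow]

end Contaminate

section LeCam

variable {n : ℕ} {E : Type*} [NormedAddCommGroup E] [NormedSpace ℝ E] [MeasurableSpace E]
  [OpensMeasurableSpace E] {lam : Fin n → unitInterval}

lemma one_le_errorProb_add_add_errorProb {P₀ P₁ : ProbabilityMeasure E} {κ₀ κ₁ : Adversary n E}
    {η : ℝ≥0∞}
    (hη : ∀ s, MeasurableSet s → contaminatedLaw lam P₁ κ₁ s ≤ contaminatedLaw lam P₀ κ₀ s + η)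
    {ρ : ℝ} (hρ : 0 ≤ ρ) (hsep : 2 * ρ ≤ ‖mean P₀ - mean P₁‖)
    {M : (Fin n → E) → E} (hM : Measurable M) :
    1 ≤ errorProb lam P₀ κ₀ M (ENNReal.ofReal (ρ ^ 2)) + η +
      errorProb lam P₁ κ₁ M (ENNReal.ofReal (ρ ^ 2)) := by
  set s : Set (Fin n → E) :=
    {z | ENNReal.ofReal (ρ ^ 2) ≤ ENNReal.ofReal (‖M z - mean P₀‖ ^ 2)}
  have hs : MeasurableSet s := measurableSet_le measurable_const <| ENNReal.measurable_ofReal.comp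
    ((by fun_prop : Continuous fun x : E => ‖x - mean P₀‖ ^ 2).measurable.comp hM)
  have hfar : sᶜ ⊆ {z | ENNReal.ofReal (ρ ^ 2) ≤ ENNReal.ofReal (‖M z - mean P₁‖ ^ 2)} := by
    intro z hz
    have hclose : ‖M z - mean P₀‖ < ρ := by
      by_contra! h
      exact hz (ENNReal.ofReal_le_ofReal (by gcongr))
    refine ENNReal.ofReal_le_ofReal (pow_le_pow_left₀ hρ ?_ 2)
    have htri := norm_sub_le_norm_sub_add_norm_sub (mean P₀) (M z) (mean P₁)
    rw [norm_sub_rev (mean P₀) (M z)] at htri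
    linarith
  calc 1 = contaminatedLaw lam P₁ κ₁ s + contaminatedLaw lam P₁ κ₁ sᶜ :=
        (prob_add_prob_compl hs).symm
    _ ≤ _ := add_le_add (hη s hs) (measure_mono hfar)

end LeCam

section GaussianLower

/-- The likelihood ratio of `N(Δ, 1)` with respect to `N(0, 1)`. -/
def gaussianRatio (Δ x : ℝ) : ℝ≥0∞ :=
  ENNReal.ofReal (Real.exp (Δ * x - Δ ^ 2 / 2))

lemma measurable_gaussianRatio (Δ : ℝ) : Measurable (gaussianRatio Δ) := by
  unfold gaussianRatio
  fun_prop

lemma withDensity_gaussianRatio (Δ : ℝ) :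
    (gaussianReal 0 1).withDensity (gaussianRatio Δ) = gaussianReal Δ 1 := by
  rw [gaussianReal_of_var_ne_zero _ one_ne_zero, gaussianReal_of_var_ne_zero _ one_ne_zero,
    ← withDensity_mul _ (measurable_gaussianPDF 0 1) (measurable_gaussianRatio Δ)]
  congr 1
  ext x
  rw [Pi.mul_apply, gaussianPDF, gaussianPDF, gaussianRatio,
    ← ENNReal.ofReal_mul (gaussianPDFReal_nonneg _ _ _), gaussianPDFReal, gaussianPDFReal,
    mul_assoc, ← Real.exp_add]
  congr 3
  push_cast
  ring

lemma lintegral_gaussianRatio (Δ : ℝ) : ∫⁻ x, gaussianRatio Δ x ∂gaussianReal 0 1 = 1 := by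
  rw [← setLIntegral_univ, ← withDensity_apply _ .univ, withDensity_gaussianRatio, measure_univ]

lemma lintegral_gaussianRatio_sq (Δ : ℝ) :
    ∫⁻ x, gaussianRatio Δ x ^ 2 ∂gaussianReal 0 1 = ENNReal.ofReal (Real.exp (Δ ^ 2)) := by
  have h : ∀ x, gaussianRatio Δ x ^ 2 =
      ENNReal.ofReal (Real.exp (Δ ^ 2)) * gaussianRatio (2 * Δ) x := fun x => by
    rw [gaussianRatio, gaussianRatio, ← ENNReal.ofReal_pow (Real.exp_pos _).le,
      ← ENNReal.ofReal_mul (Real.exp_pos _).le, ← Real.exp_nat_mul, ← Real.exp_add]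
    congr 2
    push_cast
    ring
  simp_rw [h]
  rw [lintegral_const_mul _ (measurable_gaussianRatio _), lintegral_gaussianRatio, mul_one]

lemma exp_le_one_add_two_mul {x : ℝ} (h0 : 0 ≤ x) (h1 : x ≤ 1) : Real.exp x ≤ 1 + 2 * x := by
  have h := Real.abs_exp_sub_one_le (x := x) (by rwa [abs_of_nonneg h0])
  rw [abs_of_nonneg h0] at h
  linarith [le_abs_self (Real.exp x - 1)]

lemma lintegral_gaussianRatio_sub_one_le {Δ : ℝ} (hΔ : 0 < Δ) :
    ∫⁻ x, (gaussianRatio Δ x - 1) ∂gaussianReal 0 1 ≤ ENNReal.ofReal (2 * Δ) := by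
  rcases le_total Δ 1 with h1 | h1
  · refine lintegral_tsub_one_le_of_lintegral_sq_le (measurable_gaussianRatio Δ)
      (lintegral_gaussianRatio Δ) (by simpa using hΔ) ?_
    have hexp := exp_le_one_add_two_mul (sq_nonneg Δ) (pow_le_one₀ hΔ.le h1)
    rw [lintegral_gaussianRatio_sq, ENNReal.ofNNReal_toNNReal,
      ← ENNReal.ofReal_pow (by positivity), ← ENNReal.ofReal_one,
      ← ENNReal.ofReal_add zero_le_one (by positivity)]
    exact ENNReal.ofReal_le_ofReal (by nlinarith)
  · calc ∫⁻ x, (gaussianRatio Δ x - 1) ∂gaussianReal 0 1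
        ≤ ∫⁻ x, gaussianRatio Δ x ∂gaussianReal 0 1 := lintegral_mono fun x => tsub_le_self
      _ = ENNReal.ofReal 1 := by rw [lintegral_gaussianRatio, ENNReal.ofReal_one]
      _ ≤ ENNReal.ofReal (2 * Δ) := ENNReal.ofReal_le_ofReal (by linarith)

variable {n : ℕ} {lam : Fin n → unitInterval}

lemma exists_adversaries_apply_le_add_half {Δ : ℝ} (hΔ : 0 < Δ)
    (hN : numBelow lam (2 * Δ) * Δ ^ 2 ≤ 1 / 8) {P₀ P₁ : ProbabilityMeasure ℝ}
    (hP₀ : (P₀ : Measure ℝ) = gaussianReal 0 1) (hP₁ : (P₁ : Measure ℝ) = gaussianReal Δ 1) :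
    ∃ κ₀ κ₁ : Adversary n ℝ, ∀ s, MeasurableSet s →
      contaminatedLaw lam P₁ κ₁ s ≤ contaminatedLaw lam P₀ κ₀ s + (1 / 2 : NNReal) := by
  obtain ⟨κ₀, κ₁, G, hG, hdens, hsq⟩ := exists_contaminatedLaw_eq_withDensity (P := P₀) (Q := P₁)
    (measurable_gaussianRatio Δ) (by rw [hP₀, hP₁, withDensity_gaussianRatio])
    (by positivity : 0 ≤ 2 * Δ) (by rw [hP₀]; exact lintegral_gaussianRatio_sub_one_le hΔ) lam
  have hG1 : ∫⁻ z, G z ∂contaminatedLaw lam P₀ κ₀ = 1 := by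
    rw [← setLIntegral_univ, ← withDensity_apply _ .univ, ← hdens, measure_univ]
  have hG2 : ∫⁻ z, G z ^ 2 ∂contaminatedLaw lam P₀ κ₀ ≤ 1 + ((1 / 2 : NNReal) : ℝ≥0∞) ^ 2 := by
    rw [hsq, hP₀, lintegral_gaussianRatio_sq, ← ENNReal.ofReal_pow (Real.exp_pos _).le,
      ← Real.exp_nat_mul]
    have hexp := exp_le_one_add_two_mul (by positivity : 0 ≤ numBelow lam (2 * Δ) * Δ ^ 2)
      (by linarith)
    calc _ ≤ ENNReal.ofReal ((1 + (1 / 2) ^ 2 : NNReal) : ℝ) :=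
          ENNReal.ofReal_le_ofReal (by push_cast; linarith)
      _ = _ := by rw [ENNReal.ofReal_coe_nnreal, ENNReal.coe_add, ENNReal.coe_one, ENNReal.coe_pow]
  refine ⟨κ₀, κ₁, fun s hs => ?_⟩
  rw [hdens]
  exact (withDensity_apply_le_add_lintegral_tsub_one hs).trans
    (by gcongr; exact lintegral_tsub_one_le_of_lintegral_sq_le hG hG1 (by norm_num) hG2)

lemma exists_quarter_le_errorProb {ρ : ℝ} (hρ : 0 < ρ)
    (hN : numBelow lam (4 * ρ) * (2 * ρ) ^ 2 ≤ 1 / 8) {M : (Fin n → ℝ) → ℝ} (hM : Measurable M) :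
    ∃ P ∈ unitGaussians, ∃ κ, 1 / 4 ≤ errorProb lam P κ M (ENNReal.ofReal (ρ ^ 2)) := by
  let P₀ : ProbabilityMeasure ℝ := ⟨gaussianReal 0 1, inferInstance⟩
  let P₁ : ProbabilityMeasure ℝ := ⟨gaussianReal (2 * ρ) 1, inferInstance⟩
  obtain ⟨κ₀, κ₁, hclose⟩ := exists_adversaries_apply_le_add_half (lam := lam)
    (by positivity : 0 < 2 * ρ) (by rwa [← mul_assoc, show (2 : ℝ) * 2 = 4 by norm_num])
    (P₀ := P₀) (P₁ := P₁) rfl rfl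
  have hsep : 2 * ρ ≤ ‖mean P₀ - mean P₁‖ := by
    rw [mean_eq_of_eq_gaussianReal (P := P₀) rfl, mean_eq_of_eq_gaussianReal (P := P₁) rfl,
      zero_sub, norm_neg]
    exact Real.le_norm_self _
  by_contra! hlt
  refine (one_le_errorProb_add_add_errorProb hclose hρ.le hsep hM).not_gt ?_
  calc _ < (1 / 4 : ℝ≥0∞) + (1 / 2 : NNReal) + 1 / 4 :=
        ENNReal.add_lt_add (ENNReal.add_lt_add_right ENNReal.coe_ne_top (hlt P₀ ⟨0, rfl⟩ κ₀))
          (hlt P₁ ⟨2 * ρ, rfl⟩ κ₁)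
    _ = ((1 / 4 + 1 / 2 + 1 / 4 : NNReal) : ℝ≥0∞) := by
        push_cast
        norm_num
    _ = 1 := by norm_num

lemma ofReal_mul_minRate_le_pacRate (lam : Fin n → unitInterval) {δ : ℝ≥0∞} (hδ : δ < 1 / 4) :
    ENNReal.ofReal (1 / 48) * minRate lam ≤ pacRate lam unitGaussians δ := by
  refine le_pacRate hδ fun r hr M hM => ?_
  obtain ⟨q, hrq, hq⟩ := ENNReal.lt_iff_exists_nnreal_btwn.1 hr
  have hq0 : (0 : ℝ) < q := by exact_mod_cast pos_of_gt hrq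
  have hsq : √(q : ℝ) ^ 2 = q := Real.sq_sqrt hq0.le
  have hN : numBelow lam (4 * √q) * (2 * √q) ^ 2 ≤ 1 / 8 := by
    rcases (numBelow lam (4 * √q)).eq_zero_or_pos with h | h
    · norm_num [h]
    have h' : (0 : ℝ) < numBelow lam (4 * √q) := by exact_mod_cast h
    have hle : ENNReal.ofReal q ≤
        ENNReal.ofReal (1 / 48 * ((4 * √q) ^ 2 + 1 / numBelow lam (4 * √q))) := by
      rw [ENNReal.ofReal_coe_nnreal, ENNReal.ofReal_mul (by norm_num), ← thresholdRate_eq_ofReal h]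
      exact hq.le.trans (by gcongr; exact minRate_le_thresholdRate lam _)
    rw [ENNReal.ofReal_le_ofReal_iff (by positivity), mul_pow, hsq] at hle
    have hinv : 32 * (q : ℝ) ≤ 1 / numBelow lam (4 * √q) := by linarith
    rw [le_div_iff₀ h'] at hinv
    rw [mul_pow, hsq]
    linarith
  obtain ⟨P, hP, κ, hκ⟩ := exists_quarter_le_errorProb (Real.sqrt_pos.2 hq0) hN hM
  rw [hsq, ENNReal.ofReal_coe_nnreal] at hκ
  exact ⟨P, hP, κ, hκ.trans (errorProb_anti lam P κ M hrq.le)⟩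

end GaussianLower

end HeteroRobust

end

open HeteroRobust in
theorem mainTheorem4_general :
    ∃ c a A : ℝ, 0 < c ∧ 0 < a ∧ 0 < A ∧ ∀ (n : ℕ) (lam : Fin n → unitInterval),
      ENNReal.ofReal a * minRate lam ≤ pacRate lam unitGaussians (1 / 5) ∧
      (minRate lam ≤ ENNReal.ofReal c →
        pacRate lam unitGaussians (1 / 5) ≤ ENNReal.ofReal A * minRate lam) ∧
      (∃ t ∈ Set.Icc (0 : ℝ) 1, IsMinOn (thresholdRate lam) (Set.Icc 0 1) t) ∧
      ∀ t, thresholdRate lam t ≤ ENNReal.ofReal c →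
        (∃ M : (Fin n → ℝ) → ℝ, Measurable M ∧
          ∀ z, IsTukeyMedian (thresholdWeight lam t) z (M z)) ∧
        ∀ M : (Fin n → ℝ) → ℝ, (∀ z, IsTukeyMedian (thresholdWeight lam t) z (M z)) →
          ∀ P ∈ unitGaussians, ∀ κ : Adversary n ℝ,
            errorProb lam P κ M (ENNReal.ofReal A * thresholdRate lam t) ≤ 1 / 5 := by
  refine ⟨1 / 225, 1 / 48, 225, by norm_num, by norm_num, by norm_num, fun n lam => ?_⟩
  refine ⟨ofReal_mul_minRate_le_pacRate lam (by norm_num [ENNReal.inv_lt_inv]), fun hf => ?_,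
    exists_isMinOn_thresholdRate lam, fun t hf =>
      ⟨exists_measurable_isTukeyMedian_thresholdWeight
        (ne_top_of_le_ne_top ENNReal.ofReal_ne_top hf), fun M hM P hP κ =>
      errorProb_le_one_fifth_of_thresholdRate_le hf hM hP κ⟩⟩
  obtain ⟨t, ht, hmin⟩ := exists_isMinOn_thresholdRate lam
  rw [minRate_eq_of_isMinOn ht hmin] at hf ⊢
  exact pacRate_le_ofReal_mul_thresholdRate hf

theorem mainTheorem4 :
    ∃ c a A : ℝ, 0 < c ∧ 0 < a ∧ 0 < A ∧
      ∀ (n : ℕ) (lam : Fin n → unitInterval),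
        HeteroRobust.minRate lam ≤ ENNReal.ofReal c →
        -- the minimax PAC rate is of the order of the minimum
        (ENNReal.ofReal a * HeteroRobust.minRate lam
            ≤ HeteroRobust.pacRate lam HeteroRobust.unitGaussians (1 / 5) ∧
          HeteroRobust.pacRate lam HeteroRobust.unitGaussians (1 / 5)
            ≤ ENNReal.ofReal A * HeteroRobust.minRate lam) ∧
        -- the minimum is attained
        (∃ t ∈ Set.Icc (0 : ℝ) 1, IsMinOn (HeteroRobust.thresholdRate lam) (Set.Icc 0 1) t) ∧
        -- at every minimizer, the thresholded Tukey median is an estimator that achieves the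
        -- rate, whichever of the deepest points it returns
        ∀ t ∈ Set.Icc (0 : ℝ) 1, IsMinOn (HeteroRobust.thresholdRate lam) (Set.Icc 0 1) t →
          (∃ M : (Fin n → ℝ) → ℝ, Measurable M ∧
            ∀ z, HeteroRobust.IsTukeyMedian (HeteroRobust.thresholdWeight lam t) z (M z)) ∧
          ∀ M : (Fin n → ℝ) → ℝ,
            (∀ z, HeteroRobust.IsTukeyMedian (HeteroRobust.thresholdWeight lam t) z (M z)) →
            ∀ P ∈ HeteroRobust.unitGaussians, ∀ κ : HeteroRobust.Adversary n ℝ,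
              HeteroRobust.errorProb lam P κ M (ENNReal.ofReal A * HeteroRobust.minRate lam)
                ≤ 1 / 5 := by
  obtain ⟨c, a, A, hc, ha, hA, h⟩ := mainTheorem4_general
  refine ⟨c, a, A, hc, ha, hA, fun n lam hf => ?_⟩
  obtain ⟨hlower, hupper, hattained, hmedian⟩ := h n lam
  refine ⟨⟨hlower, hupper hf⟩, hattained, fun t ht hmin => ?_⟩
  rw [HeteroRobust.minRate_eq_of_isMinOn ht hmin] at hf ⊢
  exact hmedian t hf
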